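/- Let $(\Omega,\mathbb P)$ be a probability space, let $p\in[0,1]$, and let $S=\{s_1,s_2,\dots\}$ be a countably infinite set of generators. Let $m=(m(s,t))_{s,t\in S}$ be a random Coxeter matrix: for every outcome, $m(s,t)=m(t,s)$, $m(s,s)=1$, and $m(s,t)\in\{2,3,\dots,\infty\}$ for $s\ne t$. Assume that the random variables $m(s,t)$, indexed by the unordered pairs $\{s,t\}$ with $s\neq t$, are (mutually) independent and identically distributed, with $\mathbb P(m(s,t)=2)=p$ and $\mathbb P(m(s,t)\in\{3,4,\dots,\infty\})=1-p$. Let $G_m$ be the (random) Coxeter group with generating set $S$ and Coxeter matrix $m$, and let $\varphi:\mathbb C G_m\to\mathbb C$, $\sum_{x} a_x\delta(x)\mapsto a_{\mathrm{Id}}$, be the canonical trace on its group algebra. Let $r\ge 0$ and let $V$ be a pair partition of $\{1,\dots,2r\}$, that is, a partition all of whose blocks have two elements; write its blocks as $V_i=\{e_i,f_i\}$, $1\le i\le r$, with $e_i<f_i$ and $e_1<\dots<e_r$, and put $$I(V)=\{(i,j): e_i<e_j<f_i<f_j\}.$$ Let $\mathcal W_V^N$ be the set of words $w=(w_1,\dots,w_{2r})$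 with letters in $\{s_1,\dots,s_N\}$ that define $V$, i.e. such that the nonempty preimages of single letters under $i\mapsto w_i$ are exactly the blocks of $V$. Put $$X_N=\frac1{N^r}\sum_{w\in\mathcal W_V^N}\varphi\big(\delta(w_1w_2\cdots w_{2r})\big),$$ the product $w_1\cdots w_{2r}$ being taken in $G_m$. Then each $X_N$ is a random variable (i.e. measurable), and almost surely $$X_N\longrightarrow p^{|I(V)|}\qquad (N\to\infty).$$ (Here $p^0=1$, also for $p=0$.) -/

import Mathlib

open MeasureTheory ProbabilityTheory Filter Topology

/-- The canonical trace `φ : ℂ[G] → ℂ`, `∑ a_x δ(x) ↦ a_1`, on the complex group algebra. -/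
noncomputable def canonicalTrace (G : Type*) [Group G] (a : MonoidAlgebra ℂ G) : ℂ :=
  a.coeff 1

/-- The partition of the index set given by the nonempty preimages of single letters
under the word `i ↦ w i`. -/
noncomputable def wordPartition {k : ℕ} (w : Fin k → ℕ) :
    Finpartition (Finset.univ : Finset (Fin k)) :=
  letI : DecidableRel (Setoid.ker w) := Classical.decRel _
  Finpartition.ofSetoid (Setoid.ker w)

/-- A pair partition: every block has exactly two elements. -/
def IsPairPartition {k : ℕ} (V : Finpartition (Finset.univ : Finset (Fin k))) : Prop :=
  ∀ A ∈ V.parts, A.card = 2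

open Classical in
/-- The inversion set `I(V)`, as the set of ordered pairs of blocks `({e, f}, {e', f'})` of `V`
with `e < e' < f < f'`. -/
noncomputable def inversions {k : ℕ} (V : Finpartition (Finset.univ : Finset (Fin k))) :
    Finset (Finset (Fin k) × Finset (Fin k)) :=
  (V.parts ×ˢ V.parts).filter fun q =>
    ∃ e f e' f' : Fin k, q.1 = {e, f} ∧ q.2 = {e', f'} ∧ e < e' ∧ e' < f ∧ f < f'

open Classical in
/-- The words of length `k` in the first `N` generators that define the partition `V`.
Generators are indexed by `ℕ`, so the first `N` of them have the indices `0, …, N - 1`. -/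
noncomputable def wordsDefining {k : ℕ} (V : Finpartition (Finset.univ : Finset (Fin k)))
    (N : ℕ) : Finset (Fin k → ℕ) :=
  (Fintype.piFinset fun _ => Finset.range N).filter fun w => wordPartition w = V

/-- The product `s_{w_1} ⋯ s_{w_k}` in the Coxeter group of `M`. -/
def evalWord (M : CoxeterMatrix ℕ) {k : ℕ} (w : Fin k → ℕ) : M.Group :=
  (List.ofFn fun i => M.simple (w i)).prod

/-- A random Coxeter matrix on a countably infinite set of generators: the entries at distinct
unordered pairs of distinct generators are (jointly) independent and identically distributed, equal
to `2` with probability `p`, and in `{3, 4, …, ∞}` with probability `1 - p`.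
As always for `CoxeterMatrix`, the entry `∞` is encoded by `0`; symmetry and
`m(s,s) = 1` are part of `CoxeterMatrix`. -/
structure IsRandomCoxeterMatrix {Ω : Type*} [MeasurableSpace Ω] (μ : Measure Ω) (p : ℝ)
    (m : Ω → CoxeterMatrix ℕ) : Prop where
  measurable_entry : ∀ s t : ℕ, Measurable fun ω => m ω s t
  indep : iIndepFun (fun (q : {q : ℕ × ℕ // q.1 < q.2}) ω => m ω q.1.1 q.1.2) μ
  identDistrib : ∀ s t s' t' : ℕ, s ≠ t → s' ≠ t' →
    IdentDistrib (fun ω => m ω s t) (fun ω => m ω s' t') μ μ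
  prob_eq_two : ∀ s t : ℕ, s ≠ t → μ.real {ω | m ω s t = 2} = p
  prob_ge_three : ∀ s t : ℕ, s ≠ t → μ.real {ω | 3 ≤ m ω s t ∨ m ω s t = 0} = 1 - p

/-- `X_N = N^{-r} ∑_{w} φ(eval w)`, summed over the words in `s_1, …, s_N` that define `V`, for the
Coxeter matrix `M`. -/
noncomputable def averagedTrace {r : ℕ} (V : Finpartition (Finset.univ : Finset (Fin (2 * r))))
    (N : ℕ) (M : CoxeterMatrix ℕ) : ℂ :=
  1 / (N : ℂ) ^ r * ∑ w ∈ wordsDefining V N,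
    canonicalTrace M.Group (MonoidAlgebra.single (evalWord M w) 1)

/-! The trace of a group element is 1 or 0 according to whether it is the identity, so the question
is when a word in which each letter occurs exactly twice is trivial. The answer: if and only if m(a,
b) = 2 for every pair of crossing letters (`CoxeterSystem.wordProd_eq_one_iff`). For the hard
direction write the word as p s u s v, the second s being the first repeated letter. If the product
is 1, then sus lies in the parabolic subgroup of the letters other than s. The inversion cocycle
then forces u to commute with s (`CoxeterSystem.commute_of_conj_mem_parabolic`) and, as u has no
repeated letter, each letter of u to commute with s (`CoxeterSystem.commute_of_wordProd_commute`).
The geometric representation turns this into m = 2 (`CoxeterSystem.eq_two_of_commute`). Erase both s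
and induct.

Words defining V are injective labellings of its r blocks by N letters, so X_N is N^(-r) times a sum
of indicators, each asking |I(V)| distinct independent entries to be 2, an event of probability
p^|I(V)|. Two indicators are uncorrelated unless their labellings share an entry, which forces two
coincidences of values and leaves O(N^(2r-2)) pairs. The centred average thus has second moment
O(N^(-2)), which is summable, so it tends to 0 almost surely. There are asymptotically N^r
labellings, whence the limit. -/

/-! ### The geometric representation and parabolic subgroups -/

section GeometricRepresentation

open Polynomial.Chebyshev

variable {B : Type*} (M : CoxeterMatrix B)

/-- The entry `-2 cos (π / m(i, j))` of the real Cartan matrix of a Coxeter matrix; the convention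
`π / 0 = 0` gives the value `-2` for `m(i, j) = ∞`. -/
noncomputable def CoxeterMatrix.cartan (i j : B) : ℝ := -(2 * Real.cos (Real.pi / M i j))

/-- The linear form on the geometric representation attached to a generator. -/
noncomputable def CoxeterMatrix.coroot (i : B) : Module.Dual ℝ (B →₀ ℝ) :=
  Finsupp.linearCombination ℝ (M.cartan i)

theorem CoxeterMatrix.coroot_single (i j : B) :
    M.coroot i (Finsupp.single j 1) = M.cartan i j := by
  simp [CoxeterMatrix.coroot]

theorem CoxeterMatrix.coroot_self (i : B) : M.coroot i (Finsupp.single i 1) = 2 := by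
  simp [CoxeterMatrix.coroot_single, CoxeterMatrix.cartan]

/-- The reflection by which a generator acts in the geometric representation. -/
noncomputable def CoxeterMatrix.geomReflection (i : B) : (B →₀ ℝ) ≃ₗ[ℝ] (B →₀ ℝ) :=
  Module.reflection (M.coroot_self i)

theorem CoxeterMatrix.geomReflection_apply (i : B) (v : B →₀ ℝ) :
    M.geomReflection i v = v - M.coroot i v • Finsupp.single i 1 :=
  Module.reflection_apply _ _

/-- These are the coefficients in the formula for the m-th power of a product of two reflections.
With θ = 2π/m, S_n(2 cos θ) = sin((n+1)θ)/sin θ. For m = 2k the vanishing factor is sin(kθ) = sin π;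
for m = 2k+1 it is sin((k+1)θ) + sin(kθ), since the two angles add up to 2π. -/
theorem eval_S_add_eval_S_eq_zero {m : ℕ} (hm : 3 ≤ m) :
    (S ℝ (((m : ℤ) - 1) / 2)).eval (2 * Real.cos (2 * Real.pi / m)) *
        ((S ℝ ((m : ℤ) / 2)).eval (2 * Real.cos (2 * Real.pi / m)) +
          (S ℝ (((m : ℤ) - 2) / 2)).eval (2 * Real.cos (2 * Real.pi / m))) = 0 ∧
      (S ℝ (((m : ℤ) - 2) / 2)).eval (2 * Real.cos (2 * Real.pi / m)) *
        ((S ℝ (((m : ℤ) - 1) / 2)).eval (2 * Real.cos (2 * Real.pi / m)) +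
          (S ℝ (((m : ℤ) - 3) / 2)).eval (2 * Real.cos (2 * Real.pi / m))) = 0 := by
  have hm' : (3 : ℝ) ≤ m := by exact_mod_cast hm
  set θ : ℝ := 2 * Real.pi / m with hθ
  have hmθ : m * θ = 2 * Real.pi := by rw [hθ]; field_simp
  have hsin : Real.sin θ ≠ 0 := by
    refine (Real.sin_pos_of_pos_of_lt_pi (by positivity) ?_).ne'
    rw [hθ, div_lt_iff₀ (by positivity)]
    nlinarith [Real.pi_pos]
  have hS : ∀ n : ℤ, (S ℝ n).eval (2 * Real.cos θ) = Real.sin ((n + 1) * θ) / Real.sin θ := by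
    intro n
    rw [eq_div_iff hsin, S_two_mul_real_cos]
  rcases Nat.even_or_odd' m with ⟨k, rfl | rfl⟩
  · have h1 : (((2 * k : ℕ) : ℤ) - 1) / 2 = k - 1 := by omega
    have h2 : (((2 * k : ℕ) : ℤ) - 2) / 2 = k - 1 := by omega
    have hz : (S ℝ ((k : ℤ) - 1)).eval (2 * Real.cos θ) = 0 := by
      rw [hS]
      have : (((k : ℤ) - 1 : ℤ) + 1 : ℝ) * θ = Real.pi := by
        push_cast at hmθ ⊢
        linarith
      rw [this, Real.sin_pi, zero_div]
    rw [h1, h2, hz]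
    simp
  · have h1 : (((2 * k + 1 : ℕ) : ℤ) - 1) / 2 = k := by omega
    have h2 : (((2 * k + 1 : ℕ) : ℤ) - 2) / 2 = k - 1 := by omega
    have h3 : (((2 * k + 1 : ℕ) : ℤ) - 3) / 2 = k - 1 := by omega
    have h4 : ((2 * k + 1 : ℕ) : ℤ) / 2 = k := by omega
    have hz : (S ℝ (k : ℤ)).eval (2 * Real.cos θ) +
        (S ℝ ((k : ℤ) - 1)).eval (2 * Real.cos θ) = 0 := by
      rw [hS, hS, ← add_div]
      have : (((k : ℤ) : ℝ) + 1) * θ = 2 * Real.pi - (((k : ℤ) - 1 : ℤ) + 1 : ℝ) * θ := by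
        push_cast at hmθ ⊢
        linarith
      rw [this, Real.sin_two_pi_sub]
      simp
    rw [h1, h2, h3, h4, hz]
    simp

theorem CoxeterMatrix.isLiftable_geomReflection : M.IsLiftable M.geomReflection := by
  intro i j
  by_cases hij : i = j
  · subst hij
    rw [M.diagonal, pow_one]
    ext1 v
    exact Module.involutive_reflection (M.coroot_self i) v
  have hM1 : M i j ≠ 1 := M.off_diagonal i j hij
  have ht : M.cartan i j * M.cartan j i - 2 = 2 * Real.cos (2 * Real.pi / M i j) := by
    rw [CoxeterMatrix.cartan, CoxeterMatrix.cartan, M.symmetric j i, mul_div_assoc,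
      Real.cos_two_mul]
    ring
  -- For m = 2 the angle 2π/m is π and its sine vanishes, so this case is computed directly; m = ∞,
  -- encoded by 0, imposes no relation.
  rcases Nat.lt_or_ge (M i j) 3 with h3 | h3
  · obtain h | h : M i j = 0 ∨ M i j = 2 := by omega
    · rw [h, pow_zero]
    · have hc : M.cartan i j = 0 := by simp [CoxeterMatrix.cartan, h]
      have hc' : M.cartan j i = 0 := by simp [CoxeterMatrix.cartan, M.symmetric j i, h]
      rw [h, pow_two]
      ext1 v
      simp only [LinearEquiv.mul_apply, CoxeterMatrix.geomReflection_apply, map_sub, map_smul,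
        CoxeterMatrix.coroot_self, CoxeterMatrix.coroot_single, hc, hc']
      simp only [LinearEquiv.coe_one, id_eq]
      module
  · ext1 v
    have := Module.reflection_mul_reflection_pow_apply (M.coroot_self i) (M.coroot_self j) (M i j) v
      (2 * Real.cos (2 * Real.pi / M i j))
      (by rw [CoxeterMatrix.coroot_single, CoxeterMatrix.coroot_single, ht])
    rw [(eval_S_add_eval_S_eq_zero h3).1, (eval_S_add_eval_S_eq_zero h3).2] at this
    simpa [CoxeterMatrix.geomReflection] using this

variable {M} {W : Type*} [Group W] (cs : CoxeterSystem M W)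

/-- The geometric representation of a Coxeter group. -/
noncomputable def CoxeterSystem.geomRep : W →* ((B →₀ ℝ) ≃ₗ[ℝ] (B →₀ ℝ)) :=
  cs.lift ⟨M.geomReflection, M.isLiftable_geomReflection⟩

theorem CoxeterSystem.geomRep_simple (i : B) : cs.geomRep (cs.simple i) = M.geomReflection i :=
  cs.lift_apply_simple M.isLiftable_geomReflection i

/-- With c the Cartan entry, the e_j-coefficient of s_i s_j e_j is -1 and that of s_j s_i e_j is c²
- 1. Hence cos(π/m) = 0, whereas this cosine is positive for m ≥ 3 and for m = ∞. -/
theorem CoxeterSystem.eq_two_of_commute {i j : B} (hij : i ≠ j)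
    (h : Commute (cs.simple i) (cs.simple j)) : M i j = 2 := by
  have h1 := congrArg (fun g => g (Finsupp.single j (1 : ℝ)) j) (congrArg cs.geomRep h.eq)
  have hc : M.cartan j i = M.cartan i j := by
    rw [CoxeterMatrix.cartan, CoxeterMatrix.cartan, M.symmetric j i]
  simp only [map_mul, LinearEquiv.mul_apply, CoxeterSystem.geomRep_simple,
    CoxeterMatrix.geomReflection_apply, map_sub, map_smul, CoxeterMatrix.coroot_self,
    CoxeterMatrix.coroot_single, hc] at h1
  simp [hij.symm] at h1
  have h2 : Real.cos (Real.pi / M i j) = 0 := by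
    simpa [CoxeterMatrix.cartan] using h1
  have hM1 : M i j ≠ 1 := M.off_diagonal i j hij
  by_contra hne
  refine absurd h2 (Real.cos_pos_of_mem_Ioo ⟨?_, ?_⟩).ne'
  · have : (0 : ℝ) ≤ Real.pi / M i j := by positivity
    linarith [Real.pi_pos]
  · rcases Nat.eq_zero_or_pos (M i j) with h0 | h0
    · rw [h0]; simp [Real.pi_pos]
    · have h3 : (3 : ℝ) ≤ M i j := by
        exact_mod_cast (by omega : 3 ≤ M i j)
      rw [div_lt_div_iff₀ (by linarith) (by norm_num)]
      nlinarith [Real.pi_pos]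

/-- The standard parabolic subgroup generated by a set of simple reflections. -/
def CoxeterSystem.parabolic (I : Set B) : Subgroup W := Subgroup.closure (cs.simple '' I)

theorem CoxeterSystem.simple_mem_parabolic {I : Set B} {i : B} (hi : i ∈ I) :
    cs.simple i ∈ cs.parabolic I :=
  Subgroup.subset_closure ⟨i, hi, rfl⟩

theorem CoxeterSystem.parabolic_mono {I J : Set B} (h : I ⊆ J) :
    cs.parabolic I ≤ cs.parabolic J :=
  Subgroup.closure_mono (Set.image_mono h)

theorem CoxeterSystem.wordProd_mem_parabolic {I : Set B} {ω : List B} (h : ∀ b ∈ ω, b ∈ I) :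
    cs.wordProd ω ∈ cs.parabolic I := by
  refine Subgroup.list_prod_mem _ fun x hx => ?_
  obtain ⟨b, hb, rfl⟩ := List.mem_map.1 hx
  exact cs.simple_mem_parabolic (h b hb)

/-- The reflection of i changes only the i-th coordinate. -/
theorem CoxeterSystem.geomRep_apply_of_mem_parabolic {I : Set B} {j : B} (hj : j ∉ I) {w : W}
    (hw : w ∈ cs.parabolic I) : ∀ v : B →₀ ℝ, cs.geomRep w v j = v j := by
  induction hw using Subgroup.closure_induction with
  | mem x hx =>
    obtain ⟨i, hi, rfl⟩ := hx
    intro v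
    have : i ≠ j := fun h => hj (h ▸ hi)
    simp [CoxeterSystem.geomRep_simple, CoxeterMatrix.geomReflection_apply, this]
  | one => intro v; simp
  | mul x y _ _ hx hy => intro v; rw [map_mul, LinearEquiv.mul_apply, hx, hy]
  | inv x _ hx =>
    intro v
    have := hx (cs.geomRep x⁻¹ v)
    rw [← LinearEquiv.mul_apply, ← map_mul] at this
    simpa using this.symm

theorem CoxeterSystem.simple_notMem_parabolic {I : Set B} {j : B} (hj : j ∉ I) :
    cs.simple j ∉ cs.parabolic I := by
  intro h
  have := cs.geomRep_apply_of_mem_parabolic hj h (Finsupp.single j 1)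
  simp [CoxeterSystem.geomRep_simple, CoxeterMatrix.geomReflection_apply,
    CoxeterMatrix.coroot_self] at this

end GeometricRepresentation

/-! ### The inversion cocycle and commutation with a simple reflection -/

section InversionCocycle

variable {B : Type*} {M : CoxeterMatrix B} {W : Type*} [Group W] (cs : CoxeterSystem M W)

open Classical in
/-- The action of a generator on `W × ZMod 2` that conjugates the first component and flips the
second one at the generator itself. -/
noncomputable def CoxeterSystem.flipConj (i : B) : Function.End (W × ZMod 2) :=
  fun x => (cs.simple i * x.1 * cs.simple i, x.2 + if x.1 = cs.simple i then 1 else 0)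

theorem CoxeterSystem.simple_mul_pow (i j : B) (n : ℕ) :
    cs.simple j * (cs.simple i * cs.simple j) ^ n =
      ((cs.simple i * cs.simple j) ^ n)⁻¹ * cs.simple j := by
  have h : SemiconjBy (cs.simple j) (cs.simple i * cs.simple j)
      (cs.simple i * cs.simple j)⁻¹ := by
    simp [SemiconjBy, mul_assoc]
  rw [← inv_pow]
  exact (h.pow_right n).eq

open Classical in
-- Each of the 2n letters tests the running conjugate of x.1 against one generator. Pulled back to
-- x.1, the tests are against the reflections g^(-k) s_j with g = s_i s_j.
theorem CoxeterSystem.flipConj_mul_flipConj_pow (i j : B) (n : ℕ) (x : W × ZMod 2) :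
    ((cs.flipConj i * cs.flipConj j) ^ n) x =
      ((cs.simple i * cs.simple j) ^ n * x.1 * ((cs.simple i * cs.simple j) ^ n)⁻¹,
        x.2 + ∑ k ∈ Finset.range (2 * n),
          if x.1 = ((cs.simple i * cs.simple j) ^ k)⁻¹ * cs.simple j then 1 else 0) := by
  induction n with
  | zero => simp; rfl
  | succ n ih =>
    set g := cs.simple i * cs.simple j with hg
    have hj : cs.simple j * g ^ n = (g ^ n)⁻¹ * cs.simple j := cs.simple_mul_pow i j n
    have h1 : g ^ n * x.1 * (g ^ n)⁻¹ = cs.simple j ↔ x.1 = (g ^ (2 * n))⁻¹ * cs.simple j := by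
      rw [two_mul, pow_add, mul_inv_rev, mul_assoc _ _ (cs.simple j), ← hj, mul_inv_eq_iff_eq_mul,
        eq_inv_mul_iff_mul_eq]
    have hgj : cs.simple j * cs.simple i * cs.simple j = g⁻¹ * cs.simple j := by
      rw [hg, mul_inv_rev, cs.inv_simple, cs.inv_simple]
    have h2 : cs.simple j * (g ^ n * x.1 * (g ^ n)⁻¹) * cs.simple j = cs.simple i ↔
        x.1 = (g ^ (2 * n + 1))⁻¹ * cs.simple j := by
      have e : (g ^ (2 * n + 1))⁻¹ * cs.simple j = (g ^ n)⁻¹ * (g⁻¹ * cs.simple j) * g ^ n := by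
        rw [mul_assoc, mul_assoc _ _ (g ^ n), hj, show 2 * n + 1 = n + 1 + n by ring, pow_add,
          pow_succ]
        group
      rw [e, ← hgj]
      constructor
      · intro h
        rw [← h]
        simp [mul_assoc]
      · intro h
        rw [h]
        simp [mul_assoc]
    rw [pow_succ', show ∀ (a b : Function.End (W × ZMod 2)) y, (a * b) y = a (b y) from
      fun _ _ _ => rfl, ih]
    have e : 2 * (n + 1) = 2 * n + 1 + 1 := by ring
    rw [e, Finset.sum_range_succ, Finset.sum_range_succ]
    simp only [← h1, ← h2]
    refine Prod.ext ?_ ?_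
    · change cs.simple i * (cs.simple j * _ * cs.simple j) * cs.simple i = _
      rw [pow_succ', hg]
      simp [mul_assoc]
    · change _ + _ + _ = _
      simp only [add_assoc]
      rfl

/-- Since g^m = 1, the terms k and k + m of the sum agree and cancel modulo 2. -/
theorem CoxeterSystem.isLiftable_flipConj : M.IsLiftable cs.flipConj := by
  classical
  intro i j
  funext x
  rw [CoxeterSystem.flipConj_mul_flipConj_pow, two_mul, Finset.sum_range_add]
  simp only [pow_add, cs.simple_mul_simple_pow, one_mul, inv_one, mul_one,
    CharTwo.add_self_eq_zero, add_zero]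
  rfl

/-- The action of a Coxeter group on `W × ZMod 2` lifting `CoxeterSystem.flipConj`. -/
noncomputable def CoxeterSystem.flipAction : W →* Function.End (W × ZMod 2) :=
  cs.lift ⟨cs.flipConj, cs.isLiftable_flipConj⟩

/-- The inversion cocycle: `cs.inversionParity w t` is the parity of the number of occurrences of
`t` among the inversions of any word that represents `w`. -/
noncomputable def CoxeterSystem.inversionParity (w t : W) : ZMod 2 := (cs.flipAction w (t, 0)).2

theorem CoxeterSystem.flipAction_simple (i : B) : cs.flipAction (cs.simple i) = cs.flipConj i :=
  cs.lift_apply_simple cs.isLiftable_flipConj i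

theorem CoxeterSystem.flipAction_apply (w t : W) (e : ZMod 2) :
    cs.flipAction w (t, e) = (w * t * w⁻¹, e + cs.inversionParity w t) := by
  induction w using cs.simple_induction_left generalizing e with
  | one =>
    rw [CoxeterSystem.inversionParity, map_one]
    exact Prod.ext (show t = 1 * t * 1⁻¹ by simp) (add_zero e).symm
  | mul_simple_left w i ih =>
    have key : ∀ e, cs.flipAction (cs.simple i * w) (t, e) =
        cs.flipConj i (w * t * w⁻¹, e + cs.inversionParity w t) := by
      intro e
      rw [map_mul, show ∀ (a b : Function.End (W × ZMod 2)) y, (a * b) y = a (b y) from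
        fun _ _ _ => rfl, ih, CoxeterSystem.flipAction_simple]
    rw [CoxeterSystem.inversionParity, key, key]
    refine Prod.ext ?_ ?_
    · simp [CoxeterSystem.flipConj, mul_assoc]
    · simp [CoxeterSystem.flipConj, add_assoc]

theorem CoxeterSystem.inversionParity_mul (u v t : W) :
    cs.inversionParity (u * v) t =
      cs.inversionParity v t + cs.inversionParity u (v * t * v⁻¹) := by
  rw [CoxeterSystem.inversionParity, map_mul, show ∀ (a b : Function.End (W × ZMod 2)) y,
    (a * b) y = a (b y) from fun _ _ _ => rfl, CoxeterSystem.flipAction_apply,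
    CoxeterSystem.flipAction_apply]
  simp

theorem CoxeterSystem.inversionParity_one (t : W) : cs.inversionParity 1 t = 0 := by
  rw [CoxeterSystem.inversionParity, map_one]
  rfl

open Classical in
theorem CoxeterSystem.inversionParity_simple (i : B) (t : W) :
    cs.inversionParity (cs.simple i) t = if t = cs.simple i then 1 else 0 := by
  simp [CoxeterSystem.inversionParity, CoxeterSystem.flipAction_simple, CoxeterSystem.flipConj]

/-- The inversions of a word in I are conjugates of letters of I by elements of the parabolic
subgroup; the cocycle identity carries this through products and inverses. -/
theorem CoxeterSystem.mem_parabolic_of_inversionParity_ne_zero {I : Set B} {w : W}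
    (hw : w ∈ cs.parabolic I) : ∀ t, cs.inversionParity w t ≠ 0 → t ∈ cs.parabolic I := by
  classical
  induction hw using Subgroup.closure_induction with
  | mem x hx =>
    obtain ⟨i, hi, rfl⟩ := hx
    intro t ht
    rw [CoxeterSystem.inversionParity_simple] at ht
    have : t = cs.simple i := by by_contra h; simp [h] at ht
    exact this ▸ cs.simple_mem_parabolic hi
  | one => intro t ht; exact absurd (cs.inversionParity_one t) ht
  | mul x y hx hy ihx ihy =>
    intro t ht
    rw [CoxeterSystem.inversionParity_mul] at ht
    by_cases h : cs.inversionParity y t = 0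
    · rw [h, zero_add] at ht
      have := ihx _ ht
      change y ∈ cs.parabolic I at hy
      rwa [Subgroup.mul_mem_cancel_right _ (inv_mem hy), Subgroup.mul_mem_cancel_left _ hy] at this
    · exact ihy t h
  | inv x hx ih =>
    intro t ht
    have h := cs.inversionParity_mul x x⁻¹ t
    rw [mul_inv_cancel, CoxeterSystem.inversionParity_one] at h
    have h' : cs.inversionParity x (x⁻¹ * t * x⁻¹⁻¹) ≠ 0 := by
      intro h0
      rw [h0, add_zero] at h
      exact ht h.symm
    have := ih _ h'
    change x ∈ cs.parabolic I at hx
    rwa [inv_inv, Subgroup.mul_mem_cancel_right _ hx,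
      Subgroup.mul_mem_cancel_left _ (inv_mem hx)] at this

/-- The exchange condition, for a word on the right of a reflection. -/
theorem CoxeterSystem.exists_sublist_of_inversionParity_ne_zero (ω : List B) :
    ∀ t : W, cs.inversionParity (cs.wordProd ω)⁻¹ t ≠ 0 →
      ∃ ω' : List B, ω'.Sublist ω ∧ ω'.length + 1 = ω.length ∧
        t * cs.wordProd ω = cs.wordProd ω' := by
  classical
  induction ω with
  | nil => intro t ht; simp [CoxeterSystem.inversionParity_one] at ht
  | cons c ω ih =>
    intro t ht
    rw [CoxeterSystem.wordProd_cons, mul_inv_rev, CoxeterSystem.inversionParity_mul,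
      cs.inv_simple, CoxeterSystem.inversionParity_simple] at ht
    by_cases h : t = cs.simple c
    · exact ⟨ω, List.sublist_cons_self _ _, rfl, by simp [h, CoxeterSystem.wordProd_cons]⟩
    · rw [if_neg h, zero_add] at ht
      obtain ⟨ω', h1, h2, h3⟩ := ih _ ht
      refine ⟨c :: ω', h1.cons_cons c, by simp [h2], ?_⟩
      rw [CoxeterSystem.wordProd_cons, CoxeterSystem.wordProd_cons, ← h3]
      simp [mul_assoc]

/-- If `u` and its conjugate by a simple reflection outside `I` both lie in the parabolic subgroup
of `I`, then `u` commutes with that reflection. -/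
theorem CoxeterSystem.commute_of_conj_mem_parabolic {I : Set B} {j : B} (hj : j ∉ I) {u : W}
    (hu : u ∈ cs.parabolic I) (h : cs.simple j * u * cs.simple j ∈ cs.parabolic I) :
    Commute u (cs.simple j) := by
  classical
  set g := cs.simple j * u * cs.simple j with hg
  have hs := cs.simple_notMem_parabolic hj
  have e : u * cs.simple j = cs.simple j * g := by simp [hg, mul_assoc]
  have hz : ∀ w ∈ cs.parabolic I, cs.inversionParity w (cs.simple j) = 0 := fun w hw => by
    by_contra h0
    exact hs (cs.mem_parabolic_of_inversionParity_ne_zero hw _ h0)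
  -- Evaluate the cocycle of u s_j = s_j g at s_j. The left side gives 1, and the right side gives 1
  -- only if g fixes s_j under conjugation.
  have h1 := congrArg (fun w => cs.inversionParity w (cs.simple j)) e
  simp only [CoxeterSystem.inversionParity_mul, hz g h, CoxeterSystem.inversionParity_simple,
    if_true, mul_inv_cancel_right, hz u hu, zero_add, add_zero] at h1
  have h2 : g * cs.simple j * g⁻¹ = cs.simple j := by
    by_contra h0
    simp [h0] at h1
  have h3 : g * cs.simple j = cs.simple j * g := by
    rwa [mul_inv_eq_iff_eq_mul] at h2
  have h4 : g * cs.simple j = cs.simple j * u := by simp [hg, mul_assoc]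
  change u * cs.simple j = cs.simple j * u
  rw [e, ← h3, h4]

/-- An element of the parabolic subgroup of `I` that commutes with a simple reflection outside `I`
is a product of simple reflections that do. -/
theorem CoxeterSystem.mem_parabolic_commute {I : Set B} {j : B} (hj : j ∉ I) :
    ∀ (n : ℕ) (ω : List B), ω.length ≤ n → (∀ b ∈ ω, b ∈ I) →
      Commute (cs.wordProd ω) (cs.simple j) →
      cs.wordProd ω ∈ cs.parabolic {b ∈ I | Commute (cs.simple b) (cs.simple j)} := by
  classical
  intro n
  induction n with
  | zero =>
    intro ω hn _ _
    rw [List.length_eq_zero_iff.1 (Nat.le_zero.1 hn), cs.wordProd_nil]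
    exact one_mem _
  | succ n ih =>
    intro ω hn hI hc
    rcases ω with _ | ⟨b, ω⟩
    · rw [cs.wordProd_nil]; exact one_mem _
    have hbI : b ∈ I := hI b (by simp)
    have hωI : ∀ c ∈ ω, c ∈ I := fun c hc => hI c (by simp [hc])
    have hn' : ω.length ≤ n := by simpa using hn
    -- Either s_b is an inversion of u⁻¹, and then b is shown to commute with j and is split off, or
    -- the exchange condition gives a shorter word for the same element.
    by_cases h0 : cs.inversionParity (cs.wordProd ω)⁻¹ (cs.simple b) = 0
    · set u := cs.wordProd (b :: ω) with hu
      have huI : u ∈ cs.parabolic I := cs.wordProd_mem_parabolic hI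
      have h1 : cs.inversionParity u⁻¹ (cs.simple b) ≠ 0 := by
        rw [hu, cs.wordProd_cons, mul_inv_rev, CoxeterSystem.inversionParity_mul, cs.inv_simple,
          CoxeterSystem.inversionParity_simple]
        simp [h0]
      have hc' : u⁻¹ * cs.simple j = cs.simple j * u⁻¹ := (hc.inv_left).eq
      -- Since u⁻¹ commutes with s_j, its parities at s_b and at s_j s_b s_j agree. So the latter
      -- reflection is also an inversion of u⁻¹ and lies in the parabolic subgroup.
      have h2 := congrArg (fun w => cs.inversionParity w (cs.simple j * cs.simple b * cs.simple j))
        hc'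
      have hbj : cs.simple j * cs.simple b * cs.simple j ≠ cs.simple j := by
        intro h
        have h' : cs.simple j * cs.simple b = 1 := mul_eq_right.1 h
        refine cs.simple_notMem_parabolic hj ?_
        rw [mul_eq_one_iff_eq_inv.1 h', cs.inv_simple]
        exact cs.simple_mem_parabolic hbI
      have hbj' : u⁻¹ * (cs.simple j * cs.simple b * cs.simple j) * u⁻¹⁻¹ ≠ cs.simple j := by
        intro h
        apply hbj
        have : cs.simple j * cs.simple b * cs.simple j = u * cs.simple j * u⁻¹ := by
          rw [eq_mul_inv_iff_mul_eq, ← inv_mul_eq_iff_eq_mul, ← mul_assoc]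
          simpa using h
        rw [this, hc.eq, mul_inv_cancel_right]
      simp only [CoxeterSystem.inversionParity_mul, CoxeterSystem.inversionParity_simple, if_neg hbj,
        if_neg hbj', zero_add, add_zero, cs.inv_simple] at h2
      rw [show cs.simple j * (cs.simple j * cs.simple b * cs.simple j) * cs.simple j = cs.simple b
        by simp [mul_assoc]] at h2
      rw [h2] at h1
      have h3 := cs.mem_parabolic_of_inversionParity_ne_zero (inv_mem huI) _ h1
      have h4 := cs.commute_of_conj_mem_parabolic hj (cs.simple_mem_parabolic hbI) h3
      have h5 : Commute (cs.wordProd ω) (cs.simple j) := by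
        have : cs.wordProd ω = cs.simple b * u := by simp [hu, cs.wordProd_cons]
        rw [this]
        exact h4.mul_left hc
      rw [hu, cs.wordProd_cons]
      exact mul_mem (cs.simple_mem_parabolic ⟨hbI, h4⟩) (ih ω hn' hωI h5)
    · obtain ⟨ω', h1, h2, h3⟩ := cs.exists_sublist_of_inversionParity_ne_zero ω _ h0
      rw [cs.wordProd_cons, h3] at hc ⊢
      exact ih ω' (by omega) (fun c hc => hωI c (h1.subset hc)) hc

/-- A letter that occurs exactly once in a word commuting with a simple reflection `j` that does
not occur in it commutes with `j`. -/
theorem CoxeterSystem.commute_of_wordProd_commute {x y : List B} {b j : B}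
    (hbx : b ∉ x) (hby : b ∉ y) (hj : j ∉ x ++ b :: y)
    (h : Commute (cs.wordProd (x ++ b :: y)) (cs.simple j)) :
    Commute (cs.simple b) (cs.simple j) := by
  by_contra hb
  have h1 := cs.mem_parabolic_commute (I := {c | c ∈ x ++ b :: y}) hj _ _ le_rfl
    (fun c hc => hc) h
  have h2 := cs.parabolic_mono (J := {c | c ≠ b}) (fun c hc hcb => hb (hcb ▸ hc.2)) h1
  have hx : cs.wordProd x ∈ cs.parabolic {c | c ≠ b} :=
    cs.wordProd_mem_parabolic fun c hc hcb => hbx (hcb ▸ hc)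
  have hy : cs.wordProd y ∈ cs.parabolic {c | c ≠ b} :=
    cs.wordProd_mem_parabolic fun c hc hcb => hby (hcb ▸ hc)
  -- Cancelling x and y would leave s_b in the parabolic subgroup of the letters other than b.
  rw [cs.wordProd_append, cs.wordProd_cons, Subgroup.mul_mem_cancel_left _ hx,
    Subgroup.mul_mem_cancel_right _ hy] at h2
  exact cs.simple_notMem_parabolic (I := {c | c ≠ b}) (by simp) h2

end InversionCocycle

/-! ### Triviality of words in which each letter occurs twice -/

section DoubledWords

/-- The second displayed s is the first position that repeats an earlier letter. -/
theorem List.exists_eq_append_of_not_nodup {α : Type*} (l : List α) (hl : ¬ l.Nodup) :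
    ∃ (p u v : List α) (s : α), l = p ++ s :: (u ++ s :: v) ∧ (p ++ s :: u).Nodup := by
  induction l using List.reverseRecOn with
  | nil => exact absurd List.nodup_nil hl
  | append_singleton l c ih =>
    by_cases h : l.Nodup
    · have hc : c ∈ l := by
        by_contra hc
        exact hl (List.nodup_append.2 ⟨h, List.nodup_singleton c, by
          intro a ha b hb hab
          rw [List.mem_singleton] at hb
          exact hc (hb ▸ hab ▸ ha)⟩)
      obtain ⟨p, u, rfl⟩ := List.append_of_mem hc
      exact ⟨p, u, [], c, by simp, h⟩
    · obtain ⟨p, u, v, s, rfl, hn⟩ := ih h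
      exact ⟨p, u, v ++ [c], s, by simp, hn⟩

theorem List.Sublist.of_cons_append_of_notMem {α : Type*} {s : α} {l p q : List α} (hs : s ∉ p)
    (h : (s :: l).Sublist (p ++ q)) : (s :: l).Sublist q := by
  obtain ⟨l₁, l₂, he, h₁, h₂⟩ := List.sublist_append_iff.1 h
  rcases l₁ with _ | ⟨c, l₁⟩
  · rw [List.nil_append] at he; rwa [he]
  · rw [List.cons_append, List.cons.injEq] at he
    exact absurd (h₁.subset (he.1 ▸ List.mem_cons_self)) hs

theorem List.mem_of_sublist_between {α : Type*} {s b : α} {p u v : List α} (hsb : s ≠ b)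
    (hp : s ∉ p) (hv : s ∉ v)
    (h : [s, b, s].Sublist (p ++ s :: (u ++ s :: v))) : b ∈ u := by
  have h1 := List.cons_sublist_cons.1 (List.Sublist.of_cons_append_of_notMem hp h)
  by_contra hb
  have h2 := List.Sublist.of_cons_append_of_notMem hb h1
  rw [List.sublist_cons_iff] at h2
  rcases h2 with h2 | ⟨r, h2, -⟩
  · exact hv (h2.subset (by simp))
  · exact hsb (List.cons.inj h2).1.symm

theorem List.sublist_erase_pair {α : Type*} {s : α} {l p u v : List α} (hl : s ∉ l)
    (h : l.Sublist (p ++ s :: (u ++ s :: v))) : l.Sublist (p ++ (u ++ v)) := by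
  classical
  have h1 := h.filter (fun x => decide (x ≠ s))
  rw [List.filter_eq_self.2 (fun x hx => by simpa using ne_of_mem_of_not_mem hx hl)] at h1
  refine h1.trans ?_
  simp only [List.filter_append]
  rw [List.filter_cons_of_neg (by simp), List.filter_append, List.filter_cons_of_neg (by simp)]
  exact List.filter_sublist.append (List.filter_sublist.append List.filter_sublist)

variable {B : Type*} {M : CoxeterMatrix B} {W : Type*} [Group W] (cs : CoxeterSystem M W)

theorem CoxeterSystem.commute_of_eq_two {i j : B} (h : M i j = 2) :
    Commute (cs.simple i) (cs.simple j) := by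
  have h1 := cs.simple_mul_simple_pow i j
  rw [h, pow_two, mul_eq_one_iff_eq_inv, mul_inv_rev, cs.inv_simple, cs.inv_simple] at h1
  exact h1

/-- A word in which every letter occurs exactly twice represents the identity if and only if any two
crossing letters commute. -/
theorem CoxeterSystem.wordProd_eq_one_iff [DecidableEq B] :
    ∀ (n : ℕ) (ω : List B), ω.length ≤ n → (∀ x ∈ ω, ω.count x = 2) →
      (cs.wordProd ω = 1 ↔ ∀ a b, a ≠ b → [a, b, a, b].Sublist ω → M a b = 2) := by
  intro n
  induction n with
  | zero =>
    intro ω hn _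
    rw [List.length_eq_zero_iff.1 (Nat.le_zero.1 hn)]
    simp
  | succ n ih =>
    intro ω hn hω
    by_cases hnd : ω.Nodup
    · rcases ω with _ | ⟨c, ω⟩
      · simp
      · have h1 := hω c (by simp)
        have h2 := List.nodup_iff_count_le_one.1 hnd c
        omega
    obtain ⟨p, u, v, s, rfl, hpu⟩ := List.exists_eq_append_of_not_nodup ω hnd
    have hcount : ∀ x, (p ++ s :: (u ++ s :: v)).count x = (p ++ (u ++ v)).count x +
        2 * if s = x then 1 else 0 := by
      intro x
      simp only [List.count_append, List.count_cons, beq_iff_eq]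
      ring
    have hs := hω s (by simp)
    rw [hcount, if_pos rfl, Nat.add_eq_right, List.count_eq_zero] at hs
    simp only [List.mem_append, not_or] at hs
    obtain ⟨hsp, hsu, hsv⟩ := hs
    have hω' : ∀ x ∈ p ++ (u ++ v), (p ++ (u ++ v)).count x = 2 := by
      intro x hx
      have hxs : s ≠ x := by
        rintro rfl
        simp [hsp, hsu, hsv] at hx
      have := hω x (by
        simp only [List.mem_append, List.mem_cons] at hx ⊢
        tauto)
      rw [hcount, if_neg hxs] at this
      omega
    have ih' := ih (p ++ (u ++ v)) (by simp at hn ⊢; omega) hω'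
    have hmid : (p ++ (u ++ v)).Sublist (p ++ s :: (u ++ s :: v)) :=
      (List.Sublist.refl p).append
        (((List.Sublist.refl u).append (List.sublist_cons_self s v)).trans
          (List.sublist_cons_self s _))
    have hu_nodup : u.Nodup := (List.nodup_cons.1 (List.nodup_append.1 hpu).2.1).2
    -- The second occurrence of a letter of u must lie in v, so every letter of u crosses s.
    have hu2 : ∀ b ∈ u, b ∉ p ∧ b ∈ v := by
      intro b hb
      have hbp : b ∉ p := fun hbp => (List.nodup_append.1 hpu).2.2 b hbp b (by simp [hb]) rfl
      refine ⟨hbp, ?_⟩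
      have h1 := hω' b (by simp [hb])
      rw [List.count_append, List.count_append, List.count_eq_zero.2 hbp,
        List.count_eq_one_of_mem hu_nodup hb] at h1
      exact List.count_pos_iff.1 (by omega)
    have hcross : (∀ a b, a ≠ b → [a, b, a, b].Sublist (p ++ s :: (u ++ s :: v)) → M a b = 2) ↔
        (∀ b ∈ u, M b s = 2) ∧
          ∀ a b, a ≠ b → [a, b, a, b].Sublist (p ++ (u ++ v)) → M a b = 2 := by
      constructor
      · intro h
        refine ⟨fun b hb => ?_, fun a b hab hl => h a b hab (hl.trans hmid)⟩
        rw [M.symmetric]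
        refine h s b (fun e => hsu (e ▸ hb)) ?_
        refine List.Sublist.trans ?_ (List.sublist_append_right p _)
        refine List.Sublist.cons_cons s ?_
        exact (List.singleton_sublist.2 hb).append
          (List.Sublist.cons_cons s (List.singleton_sublist.2 (hu2 b hb).2))
      · rintro ⟨h1, h2⟩ a b hab hl
        by_cases ha : s = a
        · subst ha
          rw [M.symmetric]
          refine h1 b (List.mem_of_sublist_between hab hsp hsv (List.Sublist.trans ?_ hl))
          exact List.Sublist.cons_cons _ (List.Sublist.cons_cons _ (List.Sublist.cons_cons _
            (List.nil_sublist _)))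
        by_cases hb : s = b
        · subst hb
          refine h1 a (List.mem_of_sublist_between (Ne.symm hab) hsp hsv
            (List.Sublist.trans (List.sublist_cons_self _ _) hl))
        · exact h2 a b hab (List.sublist_erase_pair (by simp [ha, hb]) hl)
    have hprod : cs.wordProd (p ++ s :: (u ++ s :: v)) =
        cs.wordProd p * (cs.simple s * cs.wordProd u * cs.simple s * cs.wordProd v) := by
      simp only [cs.wordProd_append, cs.wordProd_cons, mul_assoc]
    have hcomm : Commute (cs.wordProd u) (cs.simple s) →
        cs.wordProd (p ++ s :: (u ++ s :: v)) = cs.wordProd (p ++ (u ++ v)) := by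
      intro h
      rw [hprod, mul_assoc (cs.simple s), h.eq, ← mul_assoc (cs.simple s), cs.simple_mul_simple_self,
        one_mul, cs.wordProd_append, cs.wordProd_append]
    rw [hcross, ← ih']
    constructor
    · intro h
      have hI : ∀ l : List B, s ∉ l → cs.wordProd l ∈ cs.parabolic {c | c ≠ s} := fun l hl =>
        cs.wordProd_mem_parabolic fun c hc hcs => hl (hcs ▸ hc)
      -- Because p(sus)v = 1 and s occurs in neither p nor v.
      have hsus : cs.simple s * cs.wordProd u * cs.simple s ∈ cs.parabolic {c | c ≠ s} := by
        have h1 : cs.wordProd p * (cs.simple s * cs.wordProd u * cs.simple s * cs.wordProd v) ∈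
            cs.parabolic {c | c ≠ s} := by
          rw [← hprod, h]; exact one_mem _
        rwa [Subgroup.mul_mem_cancel_left _ (hI p hsp),
          Subgroup.mul_mem_cancel_right _ (hI v hsv)] at h1
      have hc := cs.commute_of_conj_mem_parabolic (I := {c | c ≠ s}) (by simp) (hI u hsu) hsus
      refine ⟨fun b hb => ?_, by rw [← hcomm hc, h]⟩
      refine cs.eq_two_of_commute (fun e => hsu (e ▸ hb)) ?_
      obtain ⟨x, y, rfl⟩ := List.append_of_mem hb
      have hxy := List.nodup_append.1 hu_nodup
      refine cs.commute_of_wordProd_commute (x := x) (y := y) ?_ ?_ hsu hc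
      · exact fun hbx => hxy.2.2 b hbx b (by simp) rfl
      · exact (List.nodup_cons.1 hxy.2.1).1
    · rintro ⟨h1, h2⟩
      rw [hcomm, h2]
      clear hcomm hprod hcross hu2 hu_nodup hmid ih' hω' hcount hpu hω hn hnd hsu h2
      induction u with
      | nil => rw [cs.wordProd_nil]; exact Commute.one_left _
      | cons b u ihu =>
        rw [cs.wordProd_cons]
        exact (cs.commute_of_eq_two (h1 b (by simp))).mul_left
          (ihu fun c hc => h1 c (by simp [hc]))

end DoubledWords

/-! ### Words defining a partition, as injective labellings of its blocks -/

section Words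

variable {k : ℕ}

theorem wordPartition_eq_iff (V : Finpartition (Finset.univ : Finset (Fin k))) (w : Fin k → ℕ) :
    wordPartition w = V ↔ ∀ i j, w i = w j ↔ V.part i = V.part j := by
  have key : ∀ i j, w i = w j ↔ (wordPartition w).part i = (wordPartition w).part j := by
    intro i j
    rw [← Finpartition.mem_part_iff_part_eq_part _ (Finset.mem_univ _) (Finset.mem_univ _)]
    let _ : DecidableRel (Setoid.ker w) := Classical.decRel _
    exact eq_comm.trans (Finpartition.mem_part_ofSetoid_iff_rel (s := Setoid.ker w)).symm
  constructor
  · rintro rfl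
    exact key
  · intro h
    have hpart : ∀ i, (wordPartition w).part i = V.part i := by
      intro i
      ext j
      rw [Finpartition.mem_part_iff_part_eq_part _ (Finset.mem_univ _) (Finset.mem_univ _),
        Finpartition.mem_part_iff_part_eq_part _ (Finset.mem_univ _) (Finset.mem_univ _), ← key, h]
    refine Finpartition.ext (Finset.ext fun A => ⟨fun hA => ?_, fun hA => ?_⟩)
    · obtain ⟨x, hx⟩ := (wordPartition w).nonempty_of_mem_parts hA
      rw [← (wordPartition w).part_eq_of_mem hA hx, hpart, V.part_mem]
      exact Finset.mem_univ _
    · obtain ⟨x, hx⟩ := V.nonempty_of_mem_parts hA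
      rw [← V.part_eq_of_mem hA hx, ← hpart, Finpartition.part_mem]
      exact Finset.mem_univ _

/-- The word that has the letter `f A` at the positions of the block `A`. -/
def blockWord (V : Finpartition (Finset.univ : Finset (Fin k))) (f : V.parts → ℕ) : Fin k → ℕ :=
  fun i => f ⟨V.part i, V.part_mem.2 (Finset.mem_univ i)⟩

theorem blockWord_of_mem {V : Finpartition (Finset.univ : Finset (Fin k))} (f : V.parts → ℕ)
    {A : Finset (Fin k)} (hA : A ∈ V.parts) {i : Fin k} (hi : i ∈ A) :
    blockWord V f i = f ⟨A, hA⟩ :=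
  congrArg f (Subtype.ext (V.part_eq_of_mem hA hi))

theorem blockWord_eq_iff {V : Finpartition (Finset.univ : Finset (Fin k))} {f : V.parts → ℕ}
    (hf : Function.Injective f) (i j : Fin k) :
    blockWord V f i = blockWord V f j ↔ V.part i = V.part j := by
  rw [blockWord, blockWord, hf.eq_iff, Subtype.mk.injEq]

theorem sum_wordsDefining {E : Type*} [AddCommMonoid E]
    (V : Finpartition (Finset.univ : Finset (Fin k))) (N : ℕ) (F : (Fin k → ℕ) → E) :
    ∑ w ∈ wordsDefining V N, F w =
      ∑ f : V.parts ↪ Fin N, F (blockWord V fun A => (f A : ℕ)) := by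
  symm
  have hinj : ∀ f : V.parts ↪ Fin N, Function.Injective fun A => (f A : ℕ) :=
    fun f => Fin.val_injective.comp f.injective
  refine Finset.sum_nbij (fun f : V.parts ↪ Fin N => blockWord V fun A => (f A : ℕ)) ?_ ?_ ?_
    (fun _ _ => rfl)
  · intro f _
    simp only [wordsDefining, Finset.mem_filter, Fintype.mem_piFinset, Finset.mem_range]
    exact ⟨fun i => (f _).2, (wordPartition_eq_iff V _).2 (blockWord_eq_iff (hinj f))⟩
  · intro f _ g _ hfg
    ext ⟨A, hA⟩
    obtain ⟨x, hx⟩ := V.nonempty_of_mem_parts hA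
    have := congrFun hfg x
    simpa only [blockWord_of_mem _ hA hx] using this
  · intro w hw
    simp only [wordsDefining, Finset.coe_filter, Set.mem_ofPred_eq, Fintype.mem_piFinset,
      Finset.mem_range] at hw
    obtain ⟨hN, hV⟩ := hw
    rw [wordPartition_eq_iff] at hV
    choose x hx using fun A : V.parts => V.nonempty_of_mem_parts A.2
    refine ⟨⟨fun A => ⟨w (x A), hN _⟩, ?_⟩, Finset.mem_coe.2 (Finset.mem_univ _), ?_⟩
    · intro A A' h
      have h1 : w (x A) = w (x A') := congrArg Fin.val h
      rw [hV, V.part_eq_of_mem A.2 (hx A), V.part_eq_of_mem A'.2 (hx A')] at h1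
      exact Subtype.ext h1
    · funext i
      change w (x ⟨V.part i, _⟩) = w i
      rw [hV]
      exact V.part_eq_of_mem (V.part_mem.2 (Finset.mem_univ i)) (hx ⟨V.part i, _⟩)

theorem count_ofFn (w : Fin k → ℕ) (x : ℕ) :
    (List.ofFn w).count x = (Finset.univ.filter fun i => w i = x).card := by
  rw [List.ofFn_eq_map, List.count_eq_countP, List.countP_map, List.countP_eq_length_filter,
    Finset.card_def, Finset.filter_val]
  change _ = Multiset.card (Multiset.filter _ ((List.finRange k : List (Fin k)) : Multiset (Fin k)))
  rw [Multiset.filter_coe, Multiset.coe_card]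
  congr 1

theorem quadruple_sublist_ofFn_iff (w : Fin k → ℕ) (a b c d : ℕ) :
    [a, b, c, d].Sublist (List.ofFn w) ↔
      ∃ i₁ i₂ i₃ i₄ : Fin k, i₁ < i₂ ∧ i₂ < i₃ ∧ i₃ < i₄ ∧ w i₁ = a ∧ w i₂ = b ∧ w i₃ = c ∧
        w i₄ = d := by
  rw [List.ofFn_eq_map, List.sublist_map_iff]
  constructor
  · rintro ⟨l, hl, h⟩
    have hs := (List.pairwise_lt_finRange k).sublist hl
    match l, h, hs with
    | [i₁, i₂, i₃, i₄], h, hs =>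
      simp only [List.map_cons, List.map_nil, List.cons.injEq, and_true] at h
      simp only [List.pairwise_cons, List.mem_cons, List.not_mem_nil, or_false] at hs
      exact ⟨i₁, i₂, i₃, i₄, hs.1 _ (by simp), hs.2.1 _ (by simp), hs.2.2.1 _ (by simp),
        h.1.symm, h.2.1.symm, h.2.2.1.symm, h.2.2.2.symm⟩
  · rintro ⟨i₁, i₂, i₃, i₄, h12, h23, h34, rfl, rfl, rfl, rfl⟩
    refine ⟨[i₁, i₂, i₃, i₄], ?_, rfl⟩
    have hs : [i₁, i₂, i₃, i₄].Pairwise (· < ·) := by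
      have h13 := h12.trans h23
      have h24 := h23.trans h34
      have h14 := h13.trans h34
      simp [h12, h23, h34, h13, h24, h14]
    refine List.sublist_of_subperm_of_pairwise (r := (· < ·)) ?_ hs (List.pairwise_lt_finRange k)
    exact List.subperm_of_subset (hs.imp ne_of_lt) fun i _ => List.mem_finRange i

theorem evalWord_eq_wordProd (M : CoxeterMatrix ℕ) (w : Fin k → ℕ) :
    evalWord M w = M.toCoxeterSystem.wordProd (List.ofFn w) := by
  rw [evalWord, CoxeterSystem.wordProd, List.map_ofFn]
  rfl

/-- Blocks of size two and an injective labelling make each letter occur twice, and subwords a b a b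
are then exactly the crossings of blocks. -/
theorem evalWord_blockWord_eq_one_iff (M : CoxeterMatrix ℕ)
    {V : Finpartition (Finset.univ : Finset (Fin k))} (hV : IsPairPartition V) {f : V.parts → ℕ}
    (hf : Function.Injective f) :
    evalWord M (blockWord V f) = 1 ↔
      ∀ A B : V.parts, (A.1, B.1) ∈ inversions V → M (f A) (f B) = 2 := by
  classical
  have hcount : ∀ x ∈ List.ofFn (blockWord V f), (List.ofFn (blockWord V f)).count x = 2 := by
    intro x hx
    obtain ⟨j, rfl⟩ := List.mem_ofFn.1 hx
    rw [count_ofFn, ← hV (V.part j) (V.part_mem.2 (Finset.mem_univ j))]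
    congr 1
    ext i
    rw [Finset.mem_filter, blockWord_eq_iff hf,
      Finpartition.mem_part_iff_part_eq_part _ (Finset.mem_univ _) (Finset.mem_univ _)]
    simp
  rw [evalWord_eq_wordProd,
    M.toCoxeterSystem.wordProd_eq_one_iff _ (List.ofFn (blockWord V f)) le_rfl hcount]
  constructor
  · rintro h ⟨A, hA⟩ ⟨B, hB⟩ hAB
    simp only [inversions, Finset.mem_filter] at hAB
    obtain ⟨-, e, e₁, e', e₁', h1, h2, h3, h4, h5⟩ := hAB
    subst h1 h2
    refine h _ _ ?_ ((quadruple_sublist_ofFn_iff _ _ _ _ _).2 ⟨e, e', e₁, e₁', h3, h4, h5,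
      blockWord_of_mem f hA (by simp), blockWord_of_mem f hB (by simp),
      blockWord_of_mem f hA (by simp), blockWord_of_mem f hB (by simp)⟩)
    intro hff
    have hAB' := congrArg Subtype.val (hf hff)
    have : e ∈ ({e', e₁'} : Finset (Fin k)) := by
      rw [← show ({e, e₁} : Finset (Fin k)) = {e', e₁'} from hAB']
      simp
    rw [Finset.mem_insert, Finset.mem_singleton] at this
    rcases this with rfl | rfl
    · exact lt_irrefl _ h3
    · exact lt_irrefl _ (h3.trans (h4.trans h5))
  · intro h a b hab hs
    obtain ⟨i₁, i₂, i₃, i₄, h12, h23, h34, rfl, rfl, h3, h4⟩ :=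
      (quadruple_sublist_ofFn_iff _ _ _ _ _).1 hs
    rw [blockWord_eq_iff hf] at h3 h4
    have hpair : ∀ i j : Fin k, i < j → V.part j = V.part i → V.part i = {i, j} := by
      intro i j hij hp
      symm
      refine Finset.eq_of_subset_of_card_le ?_ ?_
      · intro x hx
        rw [Finset.mem_insert, Finset.mem_singleton] at hx
        rw [Finpartition.mem_part_iff_part_eq_part _ (Finset.mem_univ _) (Finset.mem_univ _)]
        rcases hx with rfl | rfl
        · rfl
        · exact hp
      · rw [hV _ (V.part_mem.2 (Finset.mem_univ i)), Finset.card_pair hij.ne]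
    refine h ⟨_, V.part_mem.2 (Finset.mem_univ i₁)⟩ ⟨_, V.part_mem.2 (Finset.mem_univ i₂)⟩ ?_
    simp only [inversions, Finset.mem_filter, Finset.mem_product, Finpartition.part_mem,
      Finset.mem_univ, true_and]
    exact ⟨i₁, i₃, i₂, i₄, hpair _ _ (h12.trans h23) h3, hpair _ _ (h23.trans h34) h4, h12, h23,
      h34⟩

theorem card_parts_of_isPairPartition {r : ℕ}
    {V : Finpartition (Finset.univ : Finset (Fin (2 * r)))} (hV : IsPairPartition V) :
    V.parts.card = r := by
  have h := V.sum_card_parts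
  rw [Finset.sum_congr rfl hV, Finset.sum_const, Finset.card_univ, Fintype.card_fin] at h
  simp at h
  omega

end Words

/-! ### Counting pairs of labellings that share a matrix entry -/

section Counting

variable {T : Type*}

/-- The ordered pairs of letters that an embedding attaches to the elements of `E`. -/
def edgeKeys {N : ℕ} (E : Finset (T × T)) (f : T ↪ Fin N) : Finset {q : ℕ × ℕ // q.1 < q.2} :=
  (E.image fun q => (min (f q.1 : ℕ) (f q.2), max (f q.1 : ℕ) (f q.2))).subtype
    fun q => q.1 < q.2

theorem min_max_eq_iff {a b c d : ℕ} :
    (min a b, max a b) = (min c d, max c d) ↔ (a = c ∧ b = d) ∨ (a = d ∧ b = c) := by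
  rw [Prod.mk.injEq]
  omega

/-- Asymmetry of E excludes diagonal pairs and reversed duplicates, so sorting the two letters loses
nothing. -/
theorem card_edgeKeys {N : ℕ} {E : Finset (T × T)} (hE : ∀ a b, (a, b) ∈ E → (b, a) ∉ E)
    (f : T ↪ Fin N) : (edgeKeys E f).card = E.card := by
  rw [edgeKeys, Finset.card_subtype, Finset.filter_true_of_mem, Finset.card_image_of_injOn]
  · rintro ⟨a, b⟩ hab ⟨c, d⟩ hcd h
    rcases min_max_eq_iff.1 h with ⟨h1, h2⟩ | ⟨h1, h2⟩ <;> dsimp only at h1 h2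
    · rw [f.injective (Fin.ext h1), f.injective (Fin.ext h2)]
    · rw [f.injective (Fin.ext h1), f.injective (Fin.ext h2)] at hab
      exact absurd hab (hE c d hcd)
  · intro q hq
    obtain ⟨⟨a, b⟩, hab, rfl⟩ := Finset.mem_image.1 hq
    have hne : (f a : ℕ) ≠ f b := fun h => by
      rw [f.injective (Fin.ext h)] at hab
      exact hE b b hab hab
    exact min_lt_max.2 hne

theorem forall_mem_edgeKeys {N : ℕ} {E : Finset (T × T)} (hE : ∀ a b, (a, b) ∈ E → (b, a) ∉ E)
    (f : T ↪ Fin N) (M : CoxeterMatrix ℕ) :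
    (∀ κ ∈ edgeKeys E f, M κ.1.1 κ.1.2 = 2) ↔ ∀ q ∈ E, M (f q.1) (f q.2) = 2 := by
  have hM : ∀ a b : ℕ, M (min a b) (max a b) = M a b := by
    intro a b
    rcases le_total a b with h | h
    · rw [min_eq_left h, max_eq_right h]
    · rw [min_eq_right h, max_eq_left h, M.symmetric]
  constructor
  · rintro h ⟨a, b⟩ hab
    have hne : (f a : ℕ) ≠ f b := fun h => by
      rw [f.injective (Fin.ext h)] at hab
      exact hE b b hab hab
    rw [← hM]
    refine h ⟨(min (f a : ℕ) (f b), max (f a : ℕ) (f b)), min_lt_max.2 hne⟩ ?_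
    rw [edgeKeys, Finset.mem_subtype, Finset.mem_image]
    exact ⟨(a, b), hab, rfl⟩
  · rintro h ⟨q, hq⟩ hκ
    rw [edgeKeys, Finset.mem_subtype, Finset.mem_image] at hκ
    obtain ⟨⟨a, b⟩, hab, rfl⟩ := hκ
    rw [hM]
    exact h _ hab

variable [Fintype T] [DecidableEq T]

/-- The values of the second labelling at c and d are determined by the first, so overwriting them
with an arbitrary pair is injective into pairs of functions. -/
theorem card_filter_coincidence_mul_le (N : ℕ) {a b c d : T} (hcd : c ≠ d) :
    (Finset.univ.filter fun x : (T ↪ Fin N) × (T ↪ Fin N) =>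
        x.1 a = x.2 c ∧ x.1 b = x.2 d).card * N ^ 2 ≤ N ^ (2 * Fintype.card T) := by
  have h := Fintype.card_le_of_injective
    (α := {x : (T ↪ Fin N) × (T ↪ Fin N) // x.1 a = x.2 c ∧ x.1 b = x.2 d} × (Fin N × Fin N))
    (β := (T → Fin N) × (T → Fin N))
    (fun z => (z.1.1.1, Function.update (Function.update z.1.1.2 c z.2.1) d z.2.2)) ?_
  · rw [Fintype.card_prod, Fintype.card_prod, Fintype.card_prod, Fintype.card_fun,
      Fintype.card_fin, Fintype.card_subtype] at h
    rwa [pow_two, two_mul, pow_add]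
  · rintro ⟨⟨⟨f, g⟩, h1, h2⟩, x, y⟩ ⟨⟨⟨f', g'⟩, h1', h2'⟩, x', y'⟩ h
    dsimp only at h1 h2 h1' h2' h
    rw [Prod.mk.injEq, DFunLike.coe_fn_eq] at h
    obtain ⟨rfl, h⟩ := h
    have hg : g = g' := by
      ext t
      by_cases htd : t = d
      · rw [htd, ← h2, ← h2']
      by_cases htc : t = c
      · rw [htc, ← h1, ← h1']
      · have := congrFun h t
        simp only [Function.update_of_ne htd, Function.update_of_ne htc] at this
        rw [this]
    have hy : y = y' := by simpa using congrFun h d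
    have hx : x = x' := by simpa [Function.update_of_ne hcd] using congrFun h c
    subst hg hx hy
    rfl

theorem card_filter_not_disjoint_mul_le (N : ℕ) {E : Finset (T × T)}
    (hE : ∀ a b, (a, b) ∈ E → (b, a) ∉ E) :
    (Finset.univ.filter fun x : (T ↪ Fin N) × (T ↪ Fin N) =>
        ¬ Disjoint (edgeKeys E x.1) (edgeKeys E x.2)).card * N ^ 2 ≤
      Fintype.card T ^ 4 * N ^ (2 * Fintype.card T) := by
  -- A shared key is one of at most |T|^4 coincidence patterns; sorting may reverse an edge, so both
  -- orientations are included.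
  set S : Finset ((T × T) × (T × T)) := Finset.univ.filter fun z => z.2.1 ≠ z.2.2
  have hS : S.card ≤ Fintype.card T ^ 4 := by
    refine (Finset.card_le_univ S).trans (le_of_eq ?_)
    simp only [Fintype.card_prod]
    ring
  have hsub : (Finset.univ.filter fun x : (T ↪ Fin N) × (T ↪ Fin N) =>
      ¬ Disjoint (edgeKeys E x.1) (edgeKeys E x.2)) ⊆
      S.biUnion fun z => Finset.univ.filter fun x : (T ↪ Fin N) × (T ↪ Fin N) =>
        x.1 z.1.1 = x.2 z.2.1 ∧ x.1 z.1.2 = x.2 z.2.2 := by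
    rintro ⟨f, g⟩ hx
    rw [Finset.mem_filter, Finset.not_disjoint_iff] at hx
    obtain ⟨-, ⟨κ, hκ⟩, h1, h2⟩ := hx
    rw [edgeKeys, Finset.mem_subtype, Finset.mem_image] at h1 h2
    obtain ⟨⟨a, b⟩, hab, h1⟩ := h1
    obtain ⟨⟨c, d⟩, hcd, h2⟩ := h2
    have hcd' : c ≠ d := by
      rintro rfl
      exact hE c c hcd hcd
    rw [Finset.mem_biUnion]
    rcases min_max_eq_iff.1 (h1.trans h2.symm) with ⟨h3, h4⟩ | ⟨h3, h4⟩
    · exact ⟨((a, b), (c, d)), by simpa [S] using hcd', by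
        simpa using ⟨Fin.ext h3, Fin.ext h4⟩⟩
    · exact ⟨((a, b), (d, c)), by simpa [S] using hcd'.symm, by
        simpa using ⟨Fin.ext h3, Fin.ext h4⟩⟩
  calc _ ≤ (∑ z ∈ S, (Finset.univ.filter fun x : (T ↪ Fin N) × (T ↪ Fin N) =>
        x.1 z.1.1 = x.2 z.2.1 ∧ x.1 z.1.2 = x.2 z.2.2).card) * N ^ 2 :=
        Nat.mul_le_mul_right _ ((Finset.card_le_card hsub).trans Finset.card_biUnion_le)
    _ = ∑ z ∈ S, (Finset.univ.filter fun x : (T ↪ Fin N) × (T ↪ Fin N) =>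
        x.1 z.1.1 = x.2 z.2.1 ∧ x.1 z.1.2 = x.2 z.2.2).card * N ^ 2 := Finset.sum_mul _ _ _
    _ ≤ ∑ z ∈ S, N ^ (2 * Fintype.card T) := Finset.sum_le_sum fun z hz =>
        card_filter_coincidence_mul_le N (by simpa [S] using hz)
    _ = S.card * N ^ (2 * Fintype.card T) := by rw [Finset.sum_const, smul_eq_mul]
    _ ≤ _ := Nat.mul_le_mul_right _ hS

end Counting

/-! ### Second moments and almost sure convergence -/

section Probability

variable {Ω : Type*} [MeasurableSpace Ω] {μ : Measure Ω}

/-- By Tonelli the sum of the squares has finite integral, so it is finite almost everywhere and its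
terms tend to 0. -/
theorem ae_tendsto_zero_of_summable_integral_sq {f : ℕ → Ω → ℝ} (hf : ∀ n, Measurable (f n))
    (hint : ∀ n, Integrable (fun ω => f n ω ^ 2) μ) {b : ℕ → ℝ}
    (hb : ∀ n, ∫ ω, f n ω ^ 2 ∂μ ≤ b n) (hsum : Summable b) :
    ∀ᵐ ω ∂μ, Tendsto (fun n => f n ω) atTop (𝓝 0) := by
  have hm : ∀ n, Measurable fun ω => ENNReal.ofReal (f n ω ^ 2) := fun n =>
    ((hf n).pow_const 2).ennreal_ofReal
  have h1 : ∫⁻ ω, ∑' n, ENNReal.ofReal (f n ω ^ 2) ∂μ ≠ ⊤ := by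
    rw [lintegral_tsum fun n => (hm n).aemeasurable]
    refine ne_top_of_le_ne_top hsum.tsum_ofReal_ne_top (ENNReal.tsum_le_tsum fun n => ?_)
    rw [← ofReal_integral_eq_lintegral_ofReal (hint n) (ae_of_all _ fun ω => sq_nonneg _)]
    exact ENNReal.ofReal_le_ofReal (hb n)
  filter_upwards [ae_lt_top (Measurable.tsum hm) h1] with ω hω
  have h2 := ENNReal.tendsto_atTop_zero_of_tsum_ne_top hω.ne
  have h3 := (ENNReal.tendsto_toReal ENNReal.zero_ne_top).comp h2
  have h4 : Tendsto (fun n => f n ω ^ 2) atTop (𝓝 0) := by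
    simpa [Function.comp_def, ENNReal.toReal_ofReal, sq_nonneg] using h3
  have h5 := (Real.continuous_sqrt.tendsto 0).comp h4
  rw [Real.sqrt_zero] at h5
  refine (tendsto_zero_iff_abs_tendsto_zero _).2 ?_
  simpa [Function.comp_def, Real.sqrt_sq_eq_abs] using h5

variable {p : ℝ} {m : Ω → CoxeterMatrix ℕ}

/-- The event that all the entries of the random Coxeter matrix in `Q` are equal to `2`. -/
def allTwo (m : Ω → CoxeterMatrix ℕ) (Q : Finset {q : ℕ × ℕ // q.1 < q.2}) : Set Ω :=
  {ω | ∀ κ ∈ Q, m ω κ.1.1 κ.1.2 = 2}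

theorem IsRandomCoxeterMatrix.measurableSet_allTwo (hm : IsRandomCoxeterMatrix μ p m)
    (Q : Finset {q : ℕ × ℕ // q.1 < q.2}) : MeasurableSet (allTwo m Q) := by
  have : allTwo m Q = ⋂ κ ∈ Q, (fun ω => m ω κ.1.1 κ.1.2) ⁻¹' {2} := by
    ext ω
    simp [allTwo]
  rw [this]
  exact Finset.measurableSet_biInter _ fun κ _ =>
    hm.measurable_entry _ _ (MeasurableSet.singleton 2)

theorem IsRandomCoxeterMatrix.measureReal_allTwo (hm : IsRandomCoxeterMatrix μ p m)
    (Q : Finset {q : ℕ × ℕ // q.1 < q.2}) : μ.real (allTwo m Q) = p ^ Q.card := by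
  have : allTwo m Q = ⋂ κ ∈ Q, (fun ω => m ω κ.1.1 κ.1.2) ⁻¹' {2} := by
    ext ω
    simp [allTwo]
  rw [this, Measure.real, hm.indep.measure_inter_preimage_eq_mul Q
    (sets := fun _ => {2}) fun κ _ => MeasurableSet.singleton 2, ENNReal.toReal_prod]
  exact Finset.prod_eq_pow_card fun κ _ => hm.prob_eq_two _ _ κ.2.ne

/-- Both events occur exactly when all entries in Q ∪ R are 2; the covariance therefore vanishes for
disjoint Q and R. -/
theorem IsRandomCoxeterMatrix.integral_centered_mul_centered [IsProbabilityMeasure μ]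
    (hm : IsRandomCoxeterMatrix μ p m) {k : ℕ} {Q R : Finset {q : ℕ × ℕ // q.1 < q.2}}
    (hQ : Q.card = k) (hR : R.card = k) :
    ∫ ω, ((allTwo m Q).indicator 1 ω - p ^ k) * ((allTwo m R).indicator 1 ω - p ^ k) ∂μ =
      p ^ (Q ∪ R).card - p ^ k * p ^ k := by
  classical
  have hmeas := hm.measurableSet_allTwo
  have hint : ∀ Q, Integrable ((allTwo m Q).indicator (1 : Ω → ℝ)) μ := fun Q =>
    (integrable_const (1 : ℝ)).indicator (hmeas Q)
  have hQR : ∀ ω, ((allTwo m Q).indicator 1 ω - p ^ k) * ((allTwo m R).indicator 1 ω - p ^ k) =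
      (allTwo m (Q ∪ R)).indicator (1 : Ω → ℝ) ω - p ^ k * (allTwo m Q).indicator (1 : Ω → ℝ) ω -
        p ^ k * (allTwo m R).indicator (1 : Ω → ℝ) ω + p ^ k * p ^ k := by
    intro ω
    have : allTwo m (Q ∪ R) = allTwo m Q ∩ allTwo m R := by
      ext ω
      simp only [allTwo, Finset.mem_union, Set.mem_inter_iff, Set.mem_ofPred_eq]
      exact ⟨fun h => ⟨fun κ hκ => h κ (Or.inl hκ), fun κ hκ => h κ (Or.inr hκ)⟩,
        fun h κ hκ => hκ.elim (h.1 κ) (h.2 κ)⟩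
    rw [this, Set.inter_indicator_one, Pi.mul_apply]
    ring
  simp_rw [hQR]
  rw [integral_add, integral_sub, integral_sub, integral_const_mul, integral_const_mul,
    integral_indicator_one (hmeas _), integral_indicator_one (hmeas _),
    integral_indicator_one (hmeas _), hm.measureReal_allTwo, hm.measureReal_allTwo,
    hm.measureReal_allTwo, hQ, hR]
  · simp
  · exact hint _
  · exact (hint _).const_mul _
  · exact (hint _).sub ((hint _).const_mul _)
  · exact (hint _).const_mul _
  · exact ((hint _).sub ((hint _).const_mul _)).sub ((hint _).const_mul _)
  · exact integrable_const _

variable {T : Type*} [Fintype T] [DecidableEq T]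

theorem IsRandomCoxeterMatrix.integral_sq_le [IsProbabilityMeasure μ]
    (hm : IsRandomCoxeterMatrix μ p m) (hp : p ∈ Set.Icc (0 : ℝ) 1) {E : Finset (T × T)}
    (hE : ∀ a b, (a, b) ∈ E → (b, a) ∉ E) (N : ℕ) :
    Integrable (fun ω => (∑ f : T ↪ Fin N,
        ((allTwo m (edgeKeys E f)).indicator 1 ω - p ^ E.card)) ^ 2) μ ∧
      (∫ ω, (∑ f : T ↪ Fin N,
        ((allTwo m (edgeKeys E f)).indicator 1 ω - p ^ E.card)) ^ 2 ∂μ) * N ^ 2 ≤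
      (Fintype.card T : ℝ) ^ 4 * (N : ℝ) ^ (2 * Fintype.card T) := by
  have hmeas : ∀ Q, Measurable ((allTwo m Q).indicator (1 : Ω → ℝ)) := fun Q =>
    measurable_one.indicator (hm.measurableSet_allTwo Q)
  have habs : ∀ (Q) (ω : Ω), |(allTwo m Q).indicator (1 : Ω → ℝ) ω - p ^ E.card| ≤ 1 := by
    intro Q ω
    have h0 := pow_nonneg hp.1 E.card
    have h1 := pow_le_one₀ hp.1 hp.2 (n := E.card)
    rw [abs_le]
    by_cases hω : ω ∈ allTwo m Q
    · rw [Set.indicator_of_mem hω, Pi.one_apply]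
      constructor <;> linarith
    · rw [Set.indicator_of_notMem hω]
      constructor <;> linarith
  have hint : ∀ f g : T ↪ Fin N, Integrable (fun ω =>
      ((allTwo m (edgeKeys E f)).indicator 1 ω - p ^ E.card) *
        ((allTwo m (edgeKeys E g)).indicator 1 ω - p ^ E.card)) μ := by
    intro f g
    refine Integrable.of_bound (C := 1)
      (((hmeas _).sub_const _).mul ((hmeas _).sub_const _)).aestronglyMeasurable
      (ae_of_all _ fun ω => ?_)
    rw [norm_mul]
    exact mul_le_one₀ (habs _ ω) (norm_nonneg _) (habs _ ω)
  simp_rw [pow_two (∑ f : T ↪ Fin N, _), Finset.sum_mul_sum]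
  refine ⟨integrable_finsetSum _ fun f _ => integrable_finsetSum _ fun g _ => hint f g, ?_⟩
  rw [integral_finsetSum _ fun f _ => integrable_finsetSum _ fun g _ => hint f g]
  simp_rw [integral_finsetSum _ fun g _ => hint _ g]
  have hle : ∀ f g : T ↪ Fin N, ∫ ω, ((allTwo m (edgeKeys E f)).indicator 1 ω - p ^ E.card) *
        ((allTwo m (edgeKeys E g)).indicator 1 ω - p ^ E.card) ∂μ ≤
      if ¬ Disjoint (edgeKeys E f) (edgeKeys E g) then 1 else 0 := by
    intro f g
    rw [hm.integral_centered_mul_centered (card_edgeKeys hE f) (card_edgeKeys hE g)]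
    split_ifs with h
    · rw [Finset.card_union_of_disjoint h, card_edgeKeys hE, card_edgeKeys hE, pow_add,
        sub_self]
    · have h0 := mul_nonneg (pow_nonneg hp.1 E.card) (pow_nonneg hp.1 E.card)
      have h1 := pow_le_one₀ hp.1 hp.2 (n := (edgeKeys E f ∪ edgeKeys E g).card)
      linarith
  have h1 := Finset.sum_le_sum fun (f : T ↪ Fin N) (_ : f ∈ Finset.univ) =>
    Finset.sum_le_sum fun (g : T ↪ Fin N) (_ : g ∈ Finset.univ) => hle f g
  have h2 : (∑ f : T ↪ Fin N, ∑ g : T ↪ Fin N,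
      if ¬ Disjoint (edgeKeys E f) (edgeKeys E g) then (1 : ℝ) else 0) =
      ((Finset.univ.filter fun x : (T ↪ Fin N) × (T ↪ Fin N) =>
        ¬ Disjoint (edgeKeys E x.1) (edgeKeys E x.2)).card : ℝ) := by
    rw [← Fintype.sum_prod_type' (f := fun f g : T ↪ Fin N =>
      if ¬ Disjoint (edgeKeys E f) (edgeKeys E g) then (1 : ℝ) else 0), Finset.sum_boole]
  rw [h2] at h1
  refine (mul_le_mul_of_nonneg_right h1 (by positivity)).trans ?_
  exact_mod_cast card_filter_not_disjoint_mul_le N hE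

theorem IsRandomCoxeterMatrix.ae_tendsto_average [IsProbabilityMeasure μ]
    (hm : IsRandomCoxeterMatrix μ p m) (hp : p ∈ Set.Icc (0 : ℝ) 1) {E : Finset (T × T)}
    (hE : ∀ a b, (a, b) ∈ E → (b, a) ∉ E) :
    ∀ᵐ ω ∂μ, Tendsto (fun N : ℕ => 1 / (N : ℝ) ^ Fintype.card T *
      ∑ f : T ↪ Fin N, (allTwo m (edgeKeys E f)).indicator (1 : Ω → ℝ) ω) atTop
        (𝓝 (p ^ E.card)) := by
  set r := Fintype.card T with hr
  set Z : ℕ → Ω → ℝ := fun N ω =>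
    ∑ f : T ↪ Fin N, ((allTwo m (edgeKeys E f)).indicator 1 ω - p ^ E.card) with hZ
  have hZm : ∀ N, Measurable (Z N) := fun N => Finset.measurable_fun_sum _ fun f _ =>
    (measurable_one.indicator (hm.measurableSet_allTwo _)).sub_const _
  have hsq : ∀ (N : ℕ) ω, (1 / (N : ℝ) ^ r * Z N ω) ^ 2 = (1 / (N : ℝ) ^ r) ^ 2 * Z N ω ^ 2 :=
    fun N ω => mul_pow _ _ _
  -- The shift by one keeps the divisor positive.
  have h0 : ∀ᵐ ω ∂μ, Tendsto (fun N : ℕ => 1 / ((N + 1 : ℕ) : ℝ) ^ r * Z (N + 1) ω) atTop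
      (𝓝 0) := by
    refine ae_tendsto_zero_of_summable_integral_sq (fun N => (hZm _).const_mul _) (fun N => ?_)
      (b := fun N => (r : ℝ) ^ 4 * (1 / ((N + 1 : ℕ) : ℝ) ^ 2)) (fun N => ?_) ?_
    · simp_rw [hsq]
      exact (hm.integral_sq_le hp hE _).1.const_mul _
    · simp_rw [hsq]
      rw [integral_const_mul]
      have h := (hm.integral_sq_le hp hE (N + 1)).2
      have hN : (0 : ℝ) < ((N + 1 : ℕ) : ℝ) := by positivity
      rw [← le_div_iff₀ (by positivity)] at h
      refine (mul_le_mul_of_nonneg_left h (by positivity)).trans (le_of_eq ?_)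
      rw [← hr, pow_mul']
      field_simp
    · exact ((summable_nat_add_iff 1).2 (Real.summable_one_div_nat_pow.2 one_lt_two)).mul_left _
  -- The subtracted means: the falling factorial counts the labellings.
  have hdesc : Tendsto (fun N : ℕ => p ^ E.card * ((N.descFactorial r : ℝ) / (N : ℝ) ^ r)) atTop
      (𝓝 (p ^ E.card * 1)) := by
    refine Tendsto.const_mul _ ?_
    refine (Asymptotics.isEquivalent_iff_tendsto_one ?_).1 (isEquivalent_descFactorial r)
    filter_upwards [eventually_gt_atTop 0] with N hN
    positivity
  filter_upwards [h0] with ω hω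
  have h1 : Tendsto (fun N : ℕ => 1 / (N : ℝ) ^ r * Z N ω) atTop (𝓝 0) :=
    (tendsto_add_atTop_iff_nat 1).1 hω
  have h2 := h1.add hdesc
  rw [zero_add, mul_one] at h2
  refine h2.congr fun N => ?_
  simp only [hZ, Finset.sum_sub_distrib, Finset.sum_const, Finset.card_univ,
    Fintype.card_embedding_eq, Fintype.card_fin, nsmul_eq_mul]
  ring

end Probability

/-! ### Crossing blocks and the conclusion -/

/-- The first block of a crossing has the smaller left endpoint. So each crossing is counted once
and contributes one matrix entry. -/
theorem inversions_asymm {k : ℕ} {V : Finpartition (Finset.univ : Finset (Fin k))}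
    {A B : Finset (Fin k)} (h : (A, B) ∈ inversions V) : (B, A) ∉ inversions V := by
  classical
  have key : ∀ {A B : Finset (Fin k)}, (A, B) ∈ inversions V → ∃ x ∈ A, ∀ y ∈ B, x < y := by
    intro A B h
    simp only [inversions, Finset.mem_filter] at h
    obtain ⟨-, e, f, e', f', rfl, rfl, h1, h2, h3⟩ := h
    refine ⟨e, by simp, fun y hy => ?_⟩
    rw [Finset.mem_insert, Finset.mem_singleton] at hy
    rcases hy with rfl | rfl
    · exact h1
    · exact h1.trans (h2.trans h3)
  intro h'
  obtain ⟨x, hx, hxB⟩ := key h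
  obtain ⟨y, hy, hyA⟩ := key h'
  exact lt_asymm (hxB y hy) (hyA x hx)

open Classical in
/-- The inversion set as a relation on the type of blocks. -/
noncomputable def crossingBlocks {k : ℕ} (V : Finpartition (Finset.univ : Finset (Fin k))) :
    Finset (V.parts × V.parts) :=
  Finset.univ.filter fun q => (q.1.1, q.2.1) ∈ inversions V

theorem card_crossingBlocks {k : ℕ} (V : Finpartition (Finset.univ : Finset (Fin k))) :
    (crossingBlocks V).card = (inversions V).card := by
  classical
  refine Finset.card_bij (fun q _ => (q.1.1, q.2.1)) (fun q hq => ?_) (fun q _ q' _ h => ?_)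
    fun q hq => ?_
  · exact (Finset.mem_filter.1 hq).2
  · rw [Prod.mk.injEq] at h
    exact Prod.ext (Subtype.ext h.1) (Subtype.ext h.2)
  · have h := hq
    simp only [inversions, Finset.mem_filter, Finset.mem_product] at h
    exact ⟨(⟨q.1, h.1.1⟩, ⟨q.2, h.1.2⟩), Finset.mem_filter.2 ⟨Finset.mem_univ _, hq⟩, rfl⟩

theorem crossingBlocks_asymm {k : ℕ} {V : Finpartition (Finset.univ : Finset (Fin k))}
    (A B : V.parts) (h : (A, B) ∈ crossingBlocks V) : (B, A) ∉ crossingBlocks V := fun h' =>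
  inversions_asymm (Finset.mem_filter.1 h).2 (Finset.mem_filter.1 h').2

open Classical in
theorem averagedTrace_eq {Ω : Type*} (m : Ω → CoxeterMatrix ℕ) {r : ℕ}
    {V : Finpartition (Finset.univ : Finset (Fin (2 * r)))} (hV : IsPairPartition V) (N : ℕ)
    (ω : Ω) :
    averagedTrace V N (m ω) = ((1 / (N : ℝ) ^ Fintype.card V.parts *
      ∑ f : V.parts ↪ Fin N,
        (allTwo m (edgeKeys (crossingBlocks V) f)).indicator (1 : Ω → ℝ) ω : ℝ) : ℂ) := by
  rw [averagedTrace, sum_wordsDefining, Fintype.card_coe, card_parts_of_isPairPartition hV]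
  push_cast
  congr 1
  refine Finset.sum_congr rfl fun f _ => ?_
  have h1 := evalWord_blockWord_eq_one_iff (m ω) hV (Fin.val_injective.comp f.injective)
  have h2 := forall_mem_edgeKeys crossingBlocks_asymm f (m ω)
  have h3 : evalWord (m ω) (blockWord V fun A => (f A : ℕ)) = 1 ↔
      ω ∈ allTwo m (edgeKeys (crossingBlocks V) f) := by
    refine h1.trans (Iff.trans ?_ h2.symm)
    exact ⟨fun h q hq => h q.1 q.2 (Finset.mem_filter.1 hq).2,
      fun h A B hAB => h (A, B) (Finset.mem_filter.2 ⟨Finset.mem_univ _, hAB⟩)⟩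
  rw [canonicalTrace, MonoidAlgebra.coeff_single, Finsupp.single_apply, Set.indicator_apply, ← h3]
  split_ifs <;> simp

theorem mainTheorem3 {Ω : Type*} [MeasurableSpace Ω] (μ : Measure Ω) [IsProbabilityMeasure μ]
    (p : ℝ) (hp : p ∈ Set.Icc (0 : ℝ) 1) (m : Ω → CoxeterMatrix ℕ)
    (hm : IsRandomCoxeterMatrix μ p m) (r : ℕ)
    (V : Finpartition (Finset.univ : Finset (Fin (2 * r)))) (hV : IsPairPartition V) :
    (∀ N : ℕ, Measurable fun ω => averagedTrace V N (m ω)) ∧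
      ∀ᵐ ω ∂μ, Tendsto (fun N : ℕ => averagedTrace V N (m ω)) atTop
        (𝓝 ((p : ℂ) ^ (inversions V).card)) := by
  classical
  simp_rw [averagedTrace_eq m hV]
  constructor
  · intro N
    refine Complex.measurable_ofReal.comp ((Finset.measurable_fun_sum _ fun f _ => ?_).const_mul _)
    exact measurable_one.indicator (hm.measurableSet_allTwo _)
  · filter_upwards [hm.ae_tendsto_average hp (crossingBlocks_asymm (V := V))] with ω hω
    have := (Complex.continuous_ofReal.tendsto _).comp hω
    rw [card_crossingBlocks, Complex.ofReal_pow] at this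
    exact this
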